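/- Let $n\ge 1$ and let $K\subset\mathbb{R}^n$ be a convex body, i.e. a compact convex set with nonempty interior. Write $w(K)=2\int_{\mathbb{S}^{n-1}}h_K\,d\sigma$ for its mean width, where $h_K(u)=\sup_{x\in K}\langle x,u\rangle$ and $\sigma$ is the normalized surface measure on the sphere, let $B_n$ be the Euclidean unit ball, and let $K_w^*=\frac{w(K)}{w(B_n)}B_n$ be the ball centred at the origin with the same mean width as $K$. Let $I_K^\infty$ be $0$ on $K$ and $+\infty$ elsewhere, and let $\mathbb{1}_K$ be $1$ on $K$ and $0$ elsewhere. For a unit vector $u$ let $R_u(x)=x-2\langle x,u\rangle u$; the Minkowski symmetral of $\psi:\mathbb{R}^n\to(-\infty,+\infty]$ is $$\tau_u\psi(x)=\inf_{y+z=x}\left\{\tfrac12\psi(2y)+\tfrac12\psi(R_u(2z))\right\}.$$ An epi-symmetrization $\psi_{\rm sym}$ of $\psi$ is a rotation-invariant (i.e. invariant under all orthogonal transformations), convex, coercive, proper, lower semicontinuous function to which some subsequence of the successive symmetrals $\tau_{u_m}\cdots\tau_{u_1}\psi$, for some sequence $(u_i)$ of unit vectors, epi-converges. For $\alpha\in\mathbb{R}$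 and $f\ge 0$ let $\mathrm{base}_\alpha f=\frac{1-f^\alpha}{\alpha}$ if $\alpha\ne0$, $\mathrm{base}_0 f=-\log f$ (with value $+\infty$ where $f=0$); a hypo-symmetrization of $f$ is $f_{\rm sym}=(1-\alpha\psi_{\rm sym})_+^{1/\alpha}$ (for $\alpha=0$: $f_{\rm sym}=e^{-\psi_{\rm sym}}$), where $\psi_{\rm sym}$ is an epi-symmetrization of $\psi=\mathrm{base}_\alpha f$. Then $(I_K^\infty)_{\rm sym}=I_{K_w^*}^\infty$; that is, $I_{K_w^*}^\infty$ is an epi-symmetrization of $I_K^\infty$ and the only one, and there is a sequence $(u_i)$ of unit vectors for which the full sequence $\tau_{u_m}\cdots\tau_{u_1}I_K^\infty$ epi-converges to $I_{K_w^*}^\infty$. Equivalently, for every $\alpha\in\mathbb{R}$, $(\mathbb{1}_K)_{\rm sym}=\mathbb{1}_{K_w^*}$; that is, $\mathbb{1}_{K_w^*}$ is a hypo-symmetrization of $\mathbb{1}_K$ and the only one. -/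

import Mathlib

open Filter Topology MeasureTheory Metric

noncomputable section

namespace HypoSym

/-- Euclidean space `ℝⁿ`. -/
abbrev E (n : ℕ) := EuclideanSpace ℝ (Fin n)

variable {n : ℕ}

/-! ### Convex bodies and mean width -/

/-- A convex body: a compact convex set with nonempty interior. -/
structure IsConvexBody (K : Set (E n)) : Prop where
  convex : Convex ℝ K
  compact : IsCompact K
  interior_nonempty : (interior K).Nonempty

/-- The support function `h_K(u) = sup_{x ∈ K} ⟨x, u⟩` (meaningful for nonempty bounded `K`). -/
def supportFn (K : Set (E n)) (u : E n) : ℝ :=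
  sSup ((fun x : E n => inner ℝ x u) '' K)

/-- The mean width `w(K) = 2 ∫_{S^{n-1}} h_K dσ`, where `σ` is the normalized surface measure on
the unit sphere; the average integral `⨍` against the surface measure `volume.toSphere` performs
the normalization. -/
def meanWidth (K : Set (E n)) : ℝ :=
  2 * ⨍ u : sphere (0 : E n) 1, supportFn K (u : E n) ∂((volume : Measure (E n)).toSphere)

/-- The Euclidean ball `K_w^* = (w(K) / w(B_n)) B_n` centred at the origin. -/
def meanWidthBall (K : Set (E n)) : Set (E n) :=
  {y | ∃ x ∈ closedBall (0 : E n) 1,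
    y = (meanWidth K / meanWidth (closedBall (0 : E n) 1)) • x}

open scoped Classical in
/-- The convex indicator `I_K^∞`: `0` on `K` and `+∞` off `K`. -/
def convexIndicator (K : Set (E n)) (x : E n) : EReal := if x ∈ K then 0 else ⊤

/-- The characteristic function `1_K`: `1` on `K` and `0` off `K`. -/
def charFn (K : Set (E n)) : E n → ℝ := Set.indicator K (fun _ => 1)

/-! ### Coercive convex functions, epi-convergence -/

/-- The class `Conv_c(ℝⁿ)` of convex, coercive, proper, lower semicontinuous functions.
Convexity of an extended-real function means convexity of its epigraph. -/
structure IsConvC (ψ : E n → EReal) : Prop where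
  convex : Convex ℝ {p : E n × ℝ | ψ p.1 ≤ (p.2 : EReal)}
  coercive : Tendsto ψ (Bornology.cobounded (E n)) (𝓝 ⊤)
  dom_nonempty : ∃ x, ψ x < ⊤
  ne_bot : ∀ x, ψ x ≠ ⊥
  lsc : LowerSemicontinuous ψ

/-- Invariance under all orthogonal transformations, i.e. dependence on `‖x‖` only. -/
def RotationInvariant (φ : E n → EReal) : Prop :=
  ∀ (θ : E n ≃ₗᵢ[ℝ] E n) (x : E n), φ (θ x) = φ x

/-- Epi-convergence of `ψ_j` to `ψ`, in sequential form. -/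
def EpiConverges (Ψ : ℕ → E n → EReal) (ψ : E n → EReal) : Prop :=
  ∀ x : E n,
    (∀ xs : ℕ → E n, Tendsto xs atTop (𝓝 x) →
      ψ x ≤ liminf (fun j => Ψ j (xs j)) atTop) ∧
    (∃ xs : ℕ → E n, Tendsto xs atTop (𝓝 x) ∧
      Tendsto (fun j => Ψ j (xs j)) atTop (𝓝 (ψ x)))

/-! ### Minkowski symmetrization of convex functions -/

/-- The infimal convolution `(φ □ ψ)(x) = inf_{y + z = x} (φ(y) + ψ(z))`. -/
def infConv (φ ψ : E n → EReal) (x : E n) : EReal := ⨅ y : E n, φ y + ψ (x - y)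

/-- The epi-multiplication `x ↦ c ψ(x / c)` for `c > 0`. -/
def epiMul (c : ℝ) (ψ : E n → EReal) (x : E n) : EReal := (c : EReal) * ψ (c⁻¹ • x)

/-- The reflection `R_u(x) = x - 2⟨x, u⟩u` about the hyperplane `u^⊥`, for a unit vector `u`. -/
def reflect (u : sphere (0 : E n) 1) (x : E n) : E n :=
  x - (2 * inner ℝ x (u : E n)) • (u : E n)

/-- The Minkowski symmetral of `ψ` about `u^⊥`: the infimal convolution of the epi-multiples by
`1/2` of `ψ` and of its reflection `R_u ψ = ψ ∘ R_u`. -/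
def minkSym (u : sphere (0 : E n) 1) (ψ : E n → EReal) : E n → EReal :=
  infConv (epiMul (1 / 2) ψ) (epiMul (1 / 2) (fun x => ψ (reflect u x)))

/-- Successive Minkowski symmetrizations: `minkSymIter u ψ m = τ_{u_{m-1}} ∘ ⋯ ∘ τ_{u_0} ψ`. -/
def minkSymIter (u : ℕ → sphere (0 : E n) 1) (ψ : E n → EReal) : ℕ → E n → EReal
  | 0 => ψ
  | m + 1 => minkSym (u m) (minkSymIter u ψ m)

/-- `φ` is an epi-symmetrization `ψ_sym` of `ψ`: a rotation-invariant function of class `Conv_c`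
which is the epi-limit of a sequence of Minkowski symmetrizations of `ψ`. Passing to a subsequence
of the successive symmetrals is allowed; `k = id` is the whole sequence. -/
def IsEpiSymmetrization (ψ φ : E n → EReal) : Prop :=
  IsConvC φ ∧ RotationInvariant φ ∧
    ∃ (u : ℕ → sphere (0 : E n) 1) (k : ℕ → ℕ), StrictMono k ∧
      EpiConverges (fun j => minkSymIter u ψ (k j)) φ

/-! ### Base functions and hypo-symmetrization -/

/-- The base function `base_α f = (1 - f^α)/α` of a nonnegative function `f`, with
`base_0 f = -log f`. It is `+∞` off the support of `f`, for every `α` (for `α ≤ 0` this is the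
value of the formula, for `α > 0` it is what makes the base function convex). -/
def base (α : ℝ) (f : E n → ℝ) (x : E n) : EReal :=
  if f x = 0 then ⊤
  else if α = 0 then ((-Real.log (f x) : ℝ) : EReal)
  else (((1 - f x ^ α) / α : ℝ) : EReal)

/-- The function `(1 - αφ)_+^{1/α}` (`e^{-φ}` for `α = 0`), with value `0` where `φ = +∞`;
for `φ` with values in `(-∞, +∞]`. -/
def ofBase (α : ℝ) (φ : E n → EReal) (x : E n) : ℝ :=
  if φ x = ⊤ then 0
  else if α = 0 then Real.exp (-(φ x).toReal)
  else (max (1 - α * (φ x).toReal) 0) ^ (1 / α)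

/-- `g` is a hypo-symmetrization `f_sym` of `f` (as an `α`-concave function):
`g = (1 - αψ_sym)_+^{1/α}`, where `ψ` is the base function of `f`. -/
def IsHypoSymmetrization (α : ℝ) (f g : E n → ℝ) : Prop :=
  ∃ φ : E n → EReal, IsEpiSymmetrization (base α f) φ ∧ g = ofBase α φ

end HypoSym

end

noncomputable section

namespace HypoSym

variable {n : ℕ}

/-! ### Reflections -/

/-! On indicators, `minkSym` acts on sets: the symmetral of `convexIndicator K` is the indicator of
`(K + R_u K) / 2`. Support functions are thus replaced by averages `(h + h ∘ R_u) / 2`, and mean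
width is unchanged because `R_u` preserves the surface measure. Uniqueness: an epi-limit of
indicators takes only the values `0` and `⊤`, so a rotation-invariant one in `IsConvC` is the
indicator of a centred ball. Support functions then converge pointwise to its radius
(`EpiConverges.tendsto_supportFn`), and dominated convergence fixes that radius by the mean width.
Existence: run through a dense set of directions so that each recurs with bounded gaps (`rulerSeq`).
While the oscillation of the support function on the sphere exceeds some `ε`, each window of fixed
length lowers its upper bound by a fixed amount (`exists_oscillation_le`), which boundedness
forbids. The support functions therefore tend uniformly to a constant, and this forces
epi-convergence to a ball. The directions do not depend on `K`. The base function of `charFn K` is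
`convexIndicator K` for every `α`, so the hypo statement follows. -/

theorem reflect_eq_reflection (u : sphere (0 : E n) 1) (x : E n) :
    reflect u x = (Submodule.span ℝ {(u : E n)})ᗮ.reflection x := by
  have hu : ‖(u : E n)‖ = 1 := by simp
  rw [Submodule.reflection_orthogonal_apply, Submodule.reflection_singleton_apply, hu,
    real_inner_comm, reflect]
  simp [two_smul, add_smul, two_mul]

/-- The reflection `R_u` as a linear isometric equivalence. -/
def reflectIso (u : sphere (0 : E n) 1) : E n ≃ₗᵢ[ℝ] E n :=
  (Submodule.span ℝ {(u : E n)})ᗮ.reflection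

@[simp]
theorem reflectIso_apply (u : sphere (0 : E n) 1) (x : E n) : reflectIso u x = reflect u x :=
  (reflect_eq_reflection u x).symm

theorem reflect_reflect (u : sphere (0 : E n) 1) (x : E n) : reflect u (reflect u x) = x := by
  simp [reflect_eq_reflection]

theorem norm_reflect (u : sphere (0 : E n) 1) (x : E n) : ‖reflect u x‖ = ‖x‖ := by
  rw [← reflectIso_apply, LinearIsometryEquiv.norm_map]

theorem inner_reflect_left (u : sphere (0 : E n) 1) (x y : E n) :
    inner ℝ (reflect u x) y = inner ℝ x (reflect u y) := by
  simp only [reflect, inner_sub_left, inner_sub_right, inner_smul_left, inner_smul_right,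
    real_inner_comm y (u : E n)]
  simp
  ring

theorem exists_reflect_eq {x y : E n} (h : ‖x‖ = ‖y‖) (hne : x ≠ y) :
    ∃ u : sphere (0 : E n) 1, reflect u x = y := by
  have hxy : ‖x - y‖ ≠ 0 := by simpa [sub_eq_zero] using hne
  refine ⟨⟨‖x - y‖⁻¹ • (x - y), by simp [norm_smul, hxy]⟩, ?_⟩
  rw [reflect_eq_reflection]
  simp only [Submodule.span_singleton_smul_eq (IsUnit.mk0 _ (inv_ne_zero hxy))]
  exact Submodule.reflection_sub h

theorem continuous_reflect_left (x : E n) :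
    Continuous fun u : sphere (0 : E n) 1 => reflect u x := by
  unfold reflect; fun_prop

theorem continuous_reflect (u : sphere (0 : E n) 1) : Continuous (reflect u) := by
  unfold reflect; fun_prop

/-! ### Minkowski symmetrals of sets -/

/-- The Minkowski symmetral `(K + R_u K) / 2` of a set. -/
def setSym (u : sphere (0 : E n) 1) (K : Set (E n)) : Set (E n) :=
  (fun p : E n × E n => (1 / 2 : ℝ) • (p.1 + reflect u p.2)) '' (K ×ˢ K)

/-- Successive Minkowski symmetrals of a set. -/
def setSymIter (u : ℕ → sphere (0 : E n) 1) (K : Set (E n)) : ℕ → Set (E n)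
  | 0 => K
  | m + 1 => setSym (u m) (setSymIter u K m)

theorem convexIndicator_of_mem {K : Set (E n)} {x : E n} (h : x ∈ K) : convexIndicator K x = 0 :=
  if_pos h

theorem convexIndicator_of_notMem {K : Set (E n)} {x : E n} (h : x ∉ K) :
    convexIndicator K x = ⊤ :=
  if_neg h

theorem convexIndicator_nonneg (K : Set (E n)) (x : E n) : 0 ≤ convexIndicator K x := by
  unfold convexIndicator; split_ifs <;> simp

theorem convexIndicator_le_coe_iff {K : Set (E n)} {x : E n} {r : ℝ} :
    convexIndicator K x ≤ r ↔ x ∈ K ∧ 0 ≤ r := by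
  unfold convexIndicator
  split_ifs with h <;> simp [h]

theorem half_mul_convexIndicator (K : Set (E n)) (x : E n) :
    ((1 / 2 : ℝ) : EReal) * convexIndicator K x = convexIndicator K x := by
  unfold convexIndicator
  split_ifs with h
  · simp
  · exact EReal.coe_mul_top_of_pos (by norm_num)

theorem minkSym_convexIndicator (u : sphere (0 : E n) 1) (K : Set (E n)) :
    minkSym u (convexIndicator K) = convexIndicator (setSym u K) := by
  funext x
  unfold minkSym infConv epiMul
  simp only [half_mul_convexIndicator]
  have h2 : ((1 / 2 : ℝ))⁻¹ = 2 := by norm_num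
  rw [h2]
  by_cases hx : x ∈ setSym u K
  · rw [convexIndicator_of_mem hx]
    obtain ⟨⟨y, z⟩, ⟨hy, hz⟩, rfl⟩ := hx
    apply le_antisymm
    · refine iInf_le_of_le ((1 / 2 : ℝ) • y) ?_
      rw [convexIndicator_of_mem, convexIndicator_of_mem, add_zero]
      · simpa [smul_smul, reflect_reflect] using hz
      · simpa [smul_smul] using hy
    · exact le_iInf fun _ => add_nonneg (convexIndicator_nonneg _ _) (convexIndicator_nonneg _ _)
  · rw [convexIndicator_of_notMem hx, iInf_eq_top]
    intro y
    by_cases hy : (2 : ℝ) • y ∈ K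
    · by_cases hz : reflect u ((2 : ℝ) • (x - y)) ∈ K
      · refine absurd ⟨((2 : ℝ) • y, reflect u ((2 : ℝ) • (x - y))), ⟨hy, hz⟩, ?_⟩ hx
        simp only [reflect_reflect, ← smul_add, smul_smul]
        norm_num
      · rw [convexIndicator_of_notMem hz, convexIndicator_of_mem hy, zero_add]
    · rw [convexIndicator_of_notMem hy]
      -- In `EReal`, `⊤ + ⊥ = ⊥`, so the second summand must be shown to differ from `⊥`.
      exact EReal.top_add_of_ne_bot
        (ne_of_gt (lt_of_lt_of_le EReal.bot_lt_zero (convexIndicator_nonneg _ _)))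

theorem minkSymIter_convexIndicator (u : ℕ → sphere (0 : E n) 1) (K : Set (E n)) (m : ℕ) :
    minkSymIter u (convexIndicator K) m = convexIndicator (setSymIter u K m) := by
  induction m with
  | zero => rfl
  | succ m ih => rw [minkSymIter, ih, minkSym_convexIndicator, setSymIter]

theorem isCompact_setSym (u : sphere (0 : E n) 1) {K : Set (E n)} (hK : IsCompact K) :
    IsCompact (setSym u K) := by
  refine (hK.prod hK).image ?_
  have := continuous_reflect u
  fun_prop

theorem convex_setSym (u : sphere (0 : E n) 1) {K : Set (E n)} (hK : Convex ℝ K) :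
    Convex ℝ (setSym u K) := by
  have := (hK.prod hK).linear_image ((1 / 2 : ℝ) •
    (LinearMap.fst ℝ (E n) (E n) +
      (reflectIso u).toLinearEquiv.toLinearMap ∘ₗ LinearMap.snd ℝ (E n) (E n)))
  have heq : setSym u K = _ := Set.image_congr (g := ((1 / 2 : ℝ) •
    (LinearMap.fst ℝ (E n) (E n) +
      (reflectIso u).toLinearEquiv.toLinearMap ∘ₗ LinearMap.snd ℝ (E n) (E n)))) fun p _ => by simp
  rwa [heq]

theorem setSym_subset_closedBall (u : sphere (0 : E n) 1) {K : Set (E n)} {R : ℝ}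
    (hK : K ⊆ closedBall 0 R) : setSym u K ⊆ closedBall 0 R := by
  rintro _ ⟨⟨y, z⟩, ⟨hy, hz⟩, rfl⟩
  have h1 := hK hy
  have h2 := hK hz
  simp only [mem_closedBall_zero_iff] at *
  have h3 := norm_add_le y (reflect u z)
  rw [norm_reflect] at h3
  rw [norm_smul]
  norm_num
  linarith

section Iter

variable (u : ℕ → sphere (0 : E n) 1) {K : Set (E n)}

theorem isCompact_setSymIter (hK : IsCompact K) (m : ℕ) : IsCompact (setSymIter u K m) := by
  induction m with
  | zero => exact hK
  | succ m ih => exact isCompact_setSym _ ih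

theorem convex_setSymIter (hK : Convex ℝ K) (m : ℕ) : Convex ℝ (setSymIter u K m) := by
  induction m with
  | zero => exact hK
  | succ m ih => exact convex_setSym _ ih

theorem nonempty_setSymIter (hK : K.Nonempty) (m : ℕ) : (setSymIter u K m).Nonempty := by
  induction m with
  | zero => exact hK
  | succ m ih => exact (ih.prod ih).image _

theorem setSymIter_subset_closedBall {R : ℝ} (hK : K ⊆ closedBall 0 R) (m : ℕ) :
    setSymIter u K m ⊆ closedBall 0 R := by
  induction m with
  | zero => exact hK
  | succ m ih => exact setSym_subset_closedBall _ ih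

end Iter

/-! ### Support functions -/

theorem bddAbove_inner_image {K : Set (E n)} (hK : IsCompact K) (v : E n) :
    BddAbove ((fun x : E n => inner ℝ x v) '' K) :=
  (hK.image (by fun_prop)).bddAbove

theorem inner_le_supportFn {K : Set (E n)} (hK : IsCompact K) {x : E n} (hx : x ∈ K) (v : E n) :
    inner ℝ x v ≤ supportFn K v :=
  le_csSup (bddAbove_inner_image hK v) ⟨x, hx, rfl⟩

theorem exists_inner_eq_supportFn {K : Set (E n)} (hK : IsCompact K) (hne : K.Nonempty)
    (v : E n) : ∃ x ∈ K, inner ℝ x v = supportFn K v :=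
  (hK.image (f := fun x : E n => inner ℝ x v) (by fun_prop)).sSup_mem (hne.image _)

theorem supportFn_setSym (u : sphere (0 : E n) 1) {K : Set (E n)} (hK : IsCompact K)
    (hne : K.Nonempty) (v : E n) :
    supportFn (setSym u K) v = (supportFn K v + supportFn K (reflect u v)) / 2 := by
  apply le_antisymm
  · obtain ⟨x, ⟨⟨y, z⟩, ⟨hy, hz⟩, rfl⟩, hx⟩ := exists_inner_eq_supportFn (isCompact_setSym u hK)
      ((hne.prod hne).image _) v
    rw [← hx]
    have h1 := inner_le_supportFn hK hy v
    have h2 := inner_le_supportFn hK hz (reflect u v)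
    simp only [inner_smul_left, inner_add_left, inner_reflect_left]
    simp
    linarith
  · obtain ⟨y, hy, hy'⟩ := exists_inner_eq_supportFn hK hne v
    obtain ⟨z, hz, hz'⟩ := exists_inner_eq_supportFn hK hne (reflect u v)
    have := inner_le_supportFn (isCompact_setSym u hK)
      (Set.mem_image_of_mem _ (Set.mk_mem_prod hy hz)) v
    simp only [inner_smul_left, inner_add_left, inner_reflect_left, hy', hz'] at this
    simp at this
    linarith

theorem supportFn_sub_le {K : Set (E n)} (hK : IsCompact K) (hne : K.Nonempty) {R : ℝ}
    (hR : K ⊆ closedBall 0 R) (v w : E n) :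
    supportFn K v - supportFn K w ≤ R * ‖v - w‖ := by
  obtain ⟨x, hx, hx'⟩ := exists_inner_eq_supportFn hK hne v
  have h1 := inner_le_supportFn hK hx w
  have h2 : ‖x‖ ≤ R := by simpa using hR hx
  calc supportFn K v - supportFn K w ≤ inner ℝ x (v - w) := by rw [inner_sub_right]; linarith
    _ ≤ ‖x‖ * ‖v - w‖ := real_inner_le_norm _ _
    _ ≤ R * ‖v - w‖ := by gcongr

theorem abs_supportFn_le {K : Set (E n)} (hK : IsCompact K) (hne : K.Nonempty) {R : ℝ}
    (hR : K ⊆ closedBall 0 R) (v : E n) : |supportFn K v| ≤ R * ‖v‖ := by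
  obtain ⟨x, hx, hx'⟩ := exists_inner_eq_supportFn hK hne v
  rw [← hx']
  have h2 : ‖x‖ ≤ R := by simpa using hR hx
  exact (abs_real_inner_le_norm _ _).trans (by gcongr)

theorem continuous_supportFn {K : Set (E n)} (hK : IsCompact K) (hne : K.Nonempty) :
    Continuous (supportFn K) := by
  obtain ⟨R, hR⟩ := hK.isBounded.subset_closedBall 0
  have hR0 : 0 ≤ R := by
    obtain ⟨x, hx⟩ := hne
    exact (norm_nonneg x).trans (by simpa using hR hx)
  refine (LipschitzWith.of_le_add_mul ⟨R, hR0⟩ fun v w => ?_).continuous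
  have := supportFn_sub_le hK hne hR v w
  rw [← dist_eq_norm] at this
  change supportFn K v ≤ supportFn K w + R * dist v w
  linarith

theorem supportFn_closedBall {r : ℝ} (hr : 0 ≤ r) (u : sphere (0 : E n) 1) :
    supportFn (closedBall (0 : E n) r) (u : E n) = r := by
  have hu : ‖(u : E n)‖ = 1 := by simp
  apply le_antisymm
  · have := abs_supportFn_le (isCompact_closedBall (0 : E n) r) ⟨0, by simpa⟩ subset_rfl (u : E n)
    rw [hu, mul_one] at this
    exact (abs_le.1 this).2
  · have := inner_le_supportFn (isCompact_closedBall (0 : E n) r)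
      (x := r • (u : E n)) (by simp [norm_smul, abs_of_nonneg hr]) (u : E n)
    rwa [inner_smul_left, real_inner_self_eq_norm_sq, hu, one_pow, mul_one] at this

/-! ### Mean width -/

/-- The self-equivalence of the unit sphere induced by a linear isometric equivalence. -/
def sphereIso (θ : E n ≃ₗᵢ[ℝ] E n) : sphere (0 : E n) 1 ≃ₜ sphere (0 : E n) 1 where
  toFun v := ⟨θ v, by simp⟩
  invFun v := ⟨θ.symm v, by simp⟩
  left_inv v := by simp
  right_inv v := by simp
  continuous_toFun := by fun_prop
  continuous_invFun := by fun_prop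

@[simp]
theorem coe_sphereIso (θ : E n ≃ₗᵢ[ℝ] E n) (v : sphere (0 : E n) 1) :
    (sphereIso θ v : E n) = θ v := rfl

@[simp]
theorem coe_sphereIso_symm (θ : E n ≃ₗᵢ[ℝ] E n) (v : sphere (0 : E n) 1) :
    ((sphereIso θ).symm v : E n) = θ.symm v := rfl

open scoped Pointwise in
-- `toSphere` measures a set through the volume of the cone over it; `θ` carries cones to cones and
-- preserves volume.
theorem measurePreserving_sphereIso (θ : E n ≃ₗᵢ[ℝ] E n) :
    MeasurePreserving (sphereIso θ) (volume : Measure (E n)).toSphere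
      (volume : Measure (E n)).toSphere := by
  refine ⟨(sphereIso θ).continuous.measurable, ?_⟩
  ext s hs
  rw [Measure.map_apply (sphereIso θ).continuous.measurable hs, Measure.toSphere_apply' _ hs,
    Measure.toSphere_apply' _ ((sphereIso θ).continuous.measurable hs)]
  congr 1
  have hpre : θ ⁻¹' (Set.Ioo (0 : ℝ) 1 • (Subtype.val '' s)) =
      Set.Ioo (0 : ℝ) 1 • (Subtype.val '' (sphereIso θ ⁻¹' s)) := by
    ext x
    simp only [Set.mem_preimage, Set.mem_smul, Set.mem_image]
    constructor
    · rintro ⟨t, ht, _, ⟨v, hv, rfl⟩, h⟩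
      refine ⟨t, ht, _, ⟨(sphereIso θ).symm v, by simpa using hv, rfl⟩, ?_⟩
      apply θ.injective
      simpa using h
    · rintro ⟨t, ht, _, ⟨v, hv, rfl⟩, rfl⟩
      exact ⟨t, ht, _, ⟨_, hv, rfl⟩, by simp⟩
  rw [← hpre, (LinearIsometryEquiv.measurePreserving θ).measure_preimage_emb
    θ.toHomeomorph.measurableEmbedding]

theorem integrable_supportFn {K : Set (E n)} (hK : IsCompact K) (hne : K.Nonempty) :
    Integrable (fun v : sphere (0 : E n) 1 => supportFn K v)
      (volume : Measure (E n)).toSphere :=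
  ((continuous_supportFn hK hne).comp continuous_subtype_val).integrable_of_hasCompactSupport
    (HasCompactSupport.of_compactSpace _)

theorem meanWidth_setSym (u : sphere (0 : E n) 1) {K : Set (E n)} (hK : IsCompact K)
    (hne : K.Nonempty) : meanWidth (setSym u K) = meanWidth K := by
  unfold meanWidth
  congr 1
  rw [average_eq, average_eq]
  congr 1
  have hR := (measurePreserving_sphereIso (reflectIso u)).integral_comp
    (sphereIso (reflectIso u)).measurableEmbedding (fun v : sphere (0 : E n) 1 => supportFn K v)
  have hi : Integrable (fun v : sphere (0 : E n) 1 => supportFn K (reflect u v))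
      (volume : Measure (E n)).toSphere := by
    have := (measurePreserving_sphereIso (reflectIso u)).integrable_comp_of_integrable
      (integrable_supportFn hK hne)
    simpa [Function.comp_def] using this
  simp only [supportFn_setSym u hK hne]
  rw [integral_div, integral_add (integrable_supportFn hK hne) hi]
  simp only [coe_sphereIso, reflectIso_apply] at hR
  rw [hR]
  ring

theorem meanWidth_setSymIter (u : ℕ → sphere (0 : E n) 1) {K : Set (E n)} (hK : IsCompact K)
    (hne : K.Nonempty) (m : ℕ) : meanWidth (setSymIter u K m) = meanWidth K := by
  induction m with
  | zero => rfl
  | succ m ih =>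
    rw [setSymIter, meanWidth_setSym _ (isCompact_setSymIter u hK m)
      (nonempty_setSymIter u hne m), ih]

/-- Fails for `n = 0` and `r > 0`: the sphere is then empty and the average is `0`. -/
theorem meanWidth_closedBall [NeZero n] {r : ℝ} (hr : 0 ≤ r) :
    meanWidth (closedBall (0 : E n) r) = 2 * r := by
  have : NeZero (volume : Measure (E n)).toSphere := ⟨Measure.toSphere_ne_zero _⟩
  unfold meanWidth
  simp only [supportFn_closedBall hr]
  rw [average_const]

theorem meanWidthBall_eq_closedBall [NeZero n] {K : Set (E n)} {r : ℝ} (hr : 0 ≤ r)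
    (h : meanWidth K = 2 * r) : meanWidthBall K = closedBall (0 : E n) r := by
  have h1 := meanWidth_closedBall (n := n) zero_le_one
  unfold meanWidthBall
  rw [h, h1, mul_one, mul_div_cancel_left₀ _ two_ne_zero]
  ext y
  simp only [Set.mem_ofPred_eq, mem_closedBall_zero_iff]
  constructor
  · rintro ⟨x, hx, rfl⟩
    rw [norm_smul, Real.norm_of_nonneg hr]
    exact mul_le_of_le_one_right hr hx
  · intro hy
    rcases hr.eq_or_lt with rfl | hr'
    · exact ⟨0, by simp, by simpa using hy⟩
    · refine ⟨r⁻¹ • y, ?_, by rw [smul_smul, mul_inv_cancel₀ hr'.ne', one_smul]⟩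
      rw [norm_smul, Real.norm_of_nonneg (inv_nonneg.2 hr), inv_mul_le_iff₀ hr']
      simpa using hy

theorem meanWidth_eq_of_tendsto [NeZero n] {L : ℕ → Set (E n)} (hL : ∀ j, IsCompact (L j))
    (hne : ∀ j, (L j).Nonempty) {R w r : ℝ} (hR : ∀ j, L j ⊆ closedBall 0 R)
    (hw : ∀ j, meanWidth (L j) = w)
    (hr : ∀ v : sphere (0 : E n) 1, Tendsto (fun j => supportFn (L j) v) atTop (𝓝 r)) :
    w = 2 * r := by
  have : NeZero (volume : Measure (E n)).toSphere := ⟨Measure.toSphere_ne_zero _⟩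
  have hlim := tendsto_integral_of_dominated_convergence
    (μ := (volume : Measure (E n)).toSphere)
    (F := fun j (v : sphere (0 : E n) 1) => supportFn (L j) v) (f := fun _ => r)
    (fun _ => R) (fun j => (integrable_supportFn (hL j) (hne j)).1) (integrable_const _)
    (fun j => Eventually.of_forall fun v => by
      simpa using abs_supportFn_le (hL j) (hne j) (hR j) (v : E n))
    (Eventually.of_forall hr)
  have h2 : Tendsto (fun j => meanWidth (L j)) atTop (𝓝 (2 * r)) := by
    unfold meanWidth
    refine Tendsto.const_mul 2 ?_
    have h3 : (⨍ _ : sphere (0 : E n) 1, r ∂(volume : Measure (E n)).toSphere) = r :=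
      average_const _ _
    rw [average_eq] at h3
    simp only [average_eq]
    have h4 := hlim.const_smul ((volume : Measure (E n)).toSphere.real Set.univ)⁻¹
    rwa [h3] at h4
  simp only [hw] at h2
  exact tendsto_nhds_unique tendsto_const_nhds h2

/-! ### Uniqueness of the symmetrization -/

theorem EpiConverges.eq_zero_or_eq_top {L : ℕ → Set (E n)} {φ : E n → EReal}
    (h : EpiConverges (fun j => convexIndicator (L j)) φ) (x : E n) : φ x = 0 ∨ φ x = ⊤ := by
  obtain ⟨xs, -, hxs⟩ := (h x).2
  have hc : IsClosed ({0, ⊤} : Set EReal) := (Set.toFinite _).isClosed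
  have := hc.mem_of_tendsto hxs (Eventually.of_forall fun j => by
    simp only [convexIndicator]; split_ifs <;> simp)
  simpa using this

theorem EpiConverges.mem_of_tendsto {L : ℕ → Set (E n)} {C : Set (E n)}
    (h : EpiConverges (fun j => convexIndicator (L j)) (convexIndicator C))
    {x : ℕ → E n} (hx : ∀ j, x j ∈ L j) {l : ℕ → ℕ} (hl : StrictMono l) {y : E n}
    (hy : Tendsto (x ∘ l) atTop (𝓝 y)) : y ∈ C := by
  classical
  -- The liminf inequality needs a full sequence, so the indices missed by `l` are filled with the
  -- limit `y` itself.
  set z : ℕ → E n := fun j => if j ∈ Set.range l then x j else y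
  have hz : Tendsto z atTop (𝓝 y) := by
    rw [tendsto_def]
    intro U hU
    have h1 := tendsto_def.1 hy U hU
    obtain ⟨N, hN⟩ := mem_atTop_sets.1 h1
    refine mem_atTop_sets.2 ⟨l N, fun j hj => ?_⟩
    change z j ∈ U
    by_cases hjl : j ∈ Set.range l
    · obtain ⟨i, rfl⟩ := hjl
      have hzi : z (l i) = x (l i) := if_pos ⟨i, rfl⟩
      rw [hzi]
      exact hN i (hl.le_iff_le.1 hj)
    · have hzj : z j = y := if_neg hjl
      rw [hzj]
      exact mem_of_mem_nhds hU
  have h0 : convexIndicator C y ≤ 0 := by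
    refine ((h y).1 z hz).trans (liminf_le_of_frequently_le ?_)
    rw [frequently_atTop]
    intro N
    refine ⟨l N, hl.id_le N, ?_⟩
    have hzi : z (l N) = x (l N) := if_pos ⟨N, rfl⟩
    simp only [hzi]
    rw [convexIndicator_of_mem (hx _)]
  have : convexIndicator C y ≤ ((0 : ℝ) : EReal) := by simpa using h0
  exact (convexIndicator_le_coe_iff.1 this).1

theorem EpiConverges.exists_mem_tendsto {L : ℕ → Set (E n)} {C : Set (E n)}
    (h : EpiConverges (fun j => convexIndicator (L j)) (convexIndicator C)) {y : E n}
    (hy : y ∈ C) : ∃ x : ℕ → E n, Tendsto x atTop (𝓝 y) ∧ ∀ᶠ j in atTop, x j ∈ L j := by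
  obtain ⟨xs, hxs, h1⟩ := (h y).2
  refine ⟨xs, hxs, ?_⟩
  rw [convexIndicator_of_mem hy] at h1
  filter_upwards [h1.eventually_lt_const (show (0 : EReal) < ⊤ by simp)] with j hj
  by_contra hc
  simp [convexIndicator_of_notMem hc] at hj

/-- From below, a recovery sequence for `r • v` bounds the support function. From above, maximizers
along a subsequence with values at least `a > r` would cluster at a point of the ball whose inner
product with `v` exceeds `r`. -/
theorem EpiConverges.tendsto_supportFn {L : ℕ → Set (E n)} {r : ℝ} (hr : 0 ≤ r)
    (h : EpiConverges (fun j => convexIndicator (L j)) (convexIndicator (closedBall 0 r)))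
    (hL : ∀ j, IsCompact (L j)) (hne : ∀ j, (L j).Nonempty) {R : ℝ}
    (hR : ∀ j, L j ⊆ closedBall 0 R) (v : sphere (0 : E n) 1) :
    Tendsto (fun j => supportFn (L j) v) atTop (𝓝 r) := by
  have hv : ‖(v : E n)‖ = 1 := by simp
  rw [tendsto_order]
  constructor
  · intro a ha
    obtain ⟨x, hx, hxL⟩ := h.exists_mem_tendsto (y := r • (v : E n))
      (by simp [norm_smul, abs_of_nonneg hr])
    have h1 : Tendsto (fun j => inner ℝ (x j) (v : E n)) atTop (𝓝 r) := by
      have := hx.inner (tendsto_const_nhds (x := (v : E n))) (𝕜 := ℝ)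
      rwa [inner_smul_left, real_inner_self_eq_norm_sq, hv, one_pow, mul_one] at this
    filter_upwards [hxL, h1.eventually_const_lt ha] with j hj1 hj2
    exact hj2.trans_le (inner_le_supportFn (hL j) hj1 _)
  · intro a ha
    by_contra hc
    have hf : ∃ᶠ j in atTop, a ≤ supportFn (L j) v := by
      simpa [Filter.Frequently, not_le] using hc
    obtain ⟨l, hl, hla⟩ := extraction_of_frequently_atTop hf
    choose x hx hxv using fun j => exists_inner_eq_supportFn (hL j) (hne j) (v : E n)
    obtain ⟨y, -, l', hl', hy⟩ := tendsto_subseq_of_bounded (isBounded_closedBall (x := (0 : E n)))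
      (x := x ∘ l) (fun j => hR _ (hx (l j)))
    have hyr : ‖y‖ ≤ r := by simpa using h.mem_of_tendsto hx (hl.comp hl') hy
    have h1 : a ≤ inner ℝ y (v : E n) := by
      refine ge_of_tendsto (hy.inner (tendsto_const_nhds (x := (v : E n))) (𝕜 := ℝ))
        (Eventually.of_forall fun j => ?_)
      simp only [Function.comp]
      rw [hxv]
      exact hla _
    have h2 := real_inner_le_norm y (v : E n)
    rw [hv, mul_one] at h2
    linarith

/-- Reflections carry a point of maximal norm to every point of its sphere, whose convex hull is the
ball. -/
theorem exists_eq_closedBall_of_isometry_invariant [NeZero n] {C : Set (E n)} (hC : IsCompact C)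
    (hconv : Convex ℝ C) (hne : C.Nonempty)
    (hinv : ∀ (θ : E n ≃ₗᵢ[ℝ] E n), ∀ x ∈ C, θ x ∈ C) :
    ∃ r, 0 ≤ r ∧ C = closedBall 0 r := by
  obtain ⟨x, hx, hmax⟩ := hC.exists_isMaxOn hne continuous_norm.continuousOn
  refine ⟨‖x‖, norm_nonneg x, subset_antisymm (fun y hy => by simpa using hmax hy) ?_⟩
  rw [← convexHull_sphere_eq_closedBall (0 : E n) (norm_nonneg x)]
  refine convexHull_min (fun y hy => ?_) hconv
  have hxy : ‖x‖ = ‖y‖ := by simpa using hy.symm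
  by_cases h : x = y
  · exact h ▸ hx
  · obtain ⟨u, rfl⟩ := exists_reflect_eq hxy h
    simpa using hinv (reflectIso u) x hx

theorem IsConvC.isCompact_sublevel {φ : E n → EReal} (h : IsConvC φ) :
    IsCompact {x | φ x ≤ 0} := by
  refine isCompact_of_isClosed_isBounded (h.lsc.isClosed_preimage 0) ?_
  rw [← Bornology.isCobounded_compl_iff]
  have := h.coercive.eventually_const_lt (show (0 : EReal) < ⊤ by simp)
  rw [Bornology.isCobounded_def]
  filter_upwards [this] with x hx
  simpa using hx

theorem IsConvC.convex_sublevel {φ : E n → EReal} (h : IsConvC φ) :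
    Convex ℝ {x | φ x ≤ 0} := by
  intro x hx y hy a b ha hb hab
  have h1 := h.convex (x := (x, 0)) (by simpa using hx) (y := (y, 0)) (by simpa using hy) ha hb hab
  simpa using h1

theorem IsEpiSymmetrization.eq_convexIndicator_meanWidthBall [NeZero n] {K : Set (E n)}
    (hK : IsCompact K) (hne : K.Nonempty) {φ : E n → EReal}
    (h : IsEpiSymmetrization (convexIndicator K) φ) :
    φ = convexIndicator (meanWidthBall K) := by
  obtain ⟨hφ, hrot, u, k, -, hepi⟩ := h
  simp only [minkSymIter_convexIndicator] at hepi
  have hval := hepi.eq_zero_or_eq_top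
  have hφC : φ = convexIndicator {x | φ x ≤ 0} := by
    funext x
    rcases hval x with hx | hx
    · rw [convexIndicator_of_mem (by simp [hx]), hx]
    · rw [convexIndicator_of_notMem (by simp [hx]), hx]
  have hCne : {x | φ x ≤ 0}.Nonempty := by
    obtain ⟨x, hx⟩ := hφ.dom_nonempty
    exact ⟨x, ((hval x).resolve_right hx.ne).le⟩
  obtain ⟨r, hr, hC⟩ := exists_eq_closedBall_of_isometry_invariant hφ.isCompact_sublevel
    hφ.convex_sublevel hCne (fun θ x hx => by simpa [hrot θ x] using hx)
  rw [hC] at hφC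
  subst hφC
  obtain ⟨R, hR⟩ := hK.isBounded.subset_closedBall 0
  have hw := meanWidth_eq_of_tendsto (fun j => isCompact_setSymIter u hK (k j))
    (fun j => nonempty_setSymIter u hne (k j)) (fun j => setSymIter_subset_closedBall u hR (k j))
    (fun j => meanWidth_setSymIter u hK hne (k j))
    (hepi.tendsto_supportFn hr (fun j => isCompact_setSymIter u hK (k j))
      (fun j => nonempty_setSymIter u hne (k j)) (fun j => setSymIter_subset_closedBall u hR (k j)))
  rw [meanWidthBall_eq_closedBall hr hw]

/-! ### Convergence of a universal sequence of symmetrizations -/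

/-- The sequence `d 0, d 1, d 0, d 2, d 0, d 1, d 0, d 3, …`, in which every term of `d` recurs with
bounded gaps. -/
def rulerSeq {α : Type*} (d : ℕ → α) (m : ℕ) : α := d (padicValNat 2 (m + 1))

theorem exists_rulerSeq_eq {α : Type*} (d : ℕ → α) (i m : ℕ) :
    ∃ j < 2 ^ (i + 1), rulerSeq d (m + j) = d i := by
  set q := m / 2 ^ (i + 1)
  have hm := Nat.div_add_mod m (2 ^ (i + 1))
  have hlt := Nat.mod_lt m (show 2 ^ (i + 1) > 0 by positivity)
  have hp : 0 < 2 ^ i := by positivity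
  have hval : ∀ t : ℕ, padicValNat 2 (2 ^ i * (2 * t + 1)) = i := by
    intro t
    rw [padicValNat.mul (by positivity) (by omega), padicValNat.prime_pow,
      padicValNat.eq_zero_of_not_dvd (by omega), add_zero]
  rw [pow_succ] at *
  -- The indices with valuation exactly `i` are the odd multiples of `2 ^ i`. The residue of `m`
  -- decides whether the next one, as a value of `m + j + 1`, lies in the current block of length `2
  -- ^ (i + 1)` or in the following one.
  by_cases hc : m % (2 ^ i * 2) < 2 ^ i
  · refine ⟨2 ^ i - 1 - m % (2 ^ i * 2), by omega, ?_⟩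
    refine congrArg d ((congrArg (padicValNat 2) ?_).trans (hval (m / (2 ^ i * 2))))
    have : 2 ^ i * (2 * (m / (2 ^ i * 2)) + 1) = 2 ^ i * 2 * (m / (2 ^ i * 2)) + 2 ^ i := by ring
    omega
  · refine ⟨2 ^ i * 2 + 2 ^ i - 1 - m % (2 ^ i * 2), by omega, ?_⟩
    refine congrArg d ((congrArg (padicValNat 2) ?_).trans (hval (m / (2 ^ i * 2) + 1)))
    have : 2 ^ i * (2 * (m / (2 ^ i * 2) + 1) + 1) =
      2 ^ i * 2 * (m / (2 ^ i * 2)) + 2 ^ i * 2 + 2 ^ i := by ring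
    omega

/-- Some reflection takes `v` exactly to `w`, a nearby dense direction does so up to `δ`, and
compactness leaves finitely many directions. Pairs near the diagonal are excluded: for `n = 1` no
reflection fixes `v`. -/
theorem exists_forall_exists_dist_reflect_lt {d : ℕ → sphere (0 : E n) 1} (hd : DenseRange d)
    {δ : ℝ} (hδ : 0 < δ) :
    ∃ N : ℕ, ∀ v w : sphere (0 : E n) 1, δ ≤ dist v w →
      ∃ i < N, dist (reflect (d i) v) w < δ := by
  set S : Set (sphere (0 : E n) 1 × sphere (0 : E n) 1) := {p | δ ≤ dist p.1 p.2}
  have hS : IsCompact S := (isClosed_le (by fun_prop) (by fun_prop)).isCompact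
  obtain ⟨t, ht⟩ := hS.elim_finite_subcover
    (fun i => {p | dist (reflect (d i) (p.1 : E n)) (p.2 : E n) < δ})
    (fun i => isOpen_lt (by have := continuous_reflect (d i); fun_prop) (by fun_prop)) (by
      rintro ⟨v, w⟩ hvw
      have hvw' : δ ≤ dist v w := hvw
      have hne : (v : E n) ≠ w := by
        intro h
        rw [Subtype.ext h, dist_self] at hvw'
        linarith
      obtain ⟨u, hu⟩ := exists_reflect_eq (x := (v : E n)) (y := w) (by simp) hne
      have ho : IsOpen {u : sphere (0 : E n) 1 | dist (reflect u (v : E n)) (w : E n) < δ} :=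
        isOpen_lt (by have := continuous_reflect_left (v : E n); fun_prop) (by fun_prop)
      obtain ⟨i, hi⟩ := hd.exists_mem_open ho ⟨u, by simpa [hu] using hδ⟩
      exact Set.mem_iUnion.2 ⟨i, hi⟩)
  refine ⟨t.sup id + 1, fun v w hvw => ?_⟩
  obtain ⟨i, hi, h⟩ := Set.mem_iUnion₂.1 (ht (show (v, w) ∈ S from hvw))
  exact ⟨i, Nat.lt_succ_of_le (Finset.le_sup (f := id) hi), h⟩

theorem exists_window {d : ℕ → sphere (0 : E n) 1} (hd : DenseRange d) {δ : ℝ} (hδ : 0 < δ) :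
    ∃ W : ℕ, ∀ (v w : sphere (0 : E n) 1) (m : ℕ), δ ≤ dist v w →
      ∃ j < W, dist (reflect (rulerSeq d (m + j)) v) w < δ := by
  obtain ⟨N, hN⟩ := exists_forall_exists_dist_reflect_lt hd hδ
  refine ⟨2 ^ (N + 1), fun v w m hvw => ?_⟩
  obtain ⟨i, hi, h⟩ := hN v w hvw
  obtain ⟨j, hj, hj'⟩ := exists_rulerSeq_eq d i m
  refine ⟨j, hj.trans (Nat.pow_lt_pow_right (by norm_num) (by omega)), by rwa [hj']⟩

/-- `h` is the sequence of successive averages `h_{m+1} = (h_m + h_m ∘ R_{u_m}) / 2`. -/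
def IsReflectionAveraging (u : ℕ → sphere (0 : E n) 1) (h : ℕ → E n → ℝ) : Prop :=
  ∀ m v, h (m + 1) v = (h m v + h m (reflect (u m) v)) / 2

/-- The reflection `R_u` as a self-map of the unit sphere. -/
def sphereReflect (u v : sphere (0 : E n) 1) : sphere (0 : E n) 1 :=
  ⟨reflect u v, by simp [norm_reflect]⟩

namespace IsReflectionAveraging

variable {u : ℕ → sphere (0 : E n) 1} {h : ℕ → E n → ℝ}

theorem neg (H : IsReflectionAveraging u h) : IsReflectionAveraging u fun m v => -h m v := by
  intro m v
  simp only [H m v]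
  ring

theorem le_of_le (H : IsReflectionAveraging u h) {m : ℕ} {b : ℝ}
    (hb : ∀ v : sphere (0 : E n) 1, h m v ≤ b) (k : ℕ) (v : sphere (0 : E n) 1) :
    h (m + k) v ≤ b := by
  induction k generalizing v with
  | zero => exact hb v
  | succ k ih =>
    have h1 := ih v
    have h2 : h (m + k) (reflect (u (m + k)) v) ≤ b := ih (sphereReflect _ v)
    rw [← add_assoc, H]
    linarith

/-- Averaging with a value at most `b` at worst halves the deficit below `b`. -/
theorem le_sub_of_le_sub (H : IsReflectionAveraging u h) {m : ℕ} {b c : ℝ}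
    (hb : ∀ v : sphere (0 : E n) 1, h m v ≤ b) {v : sphere (0 : E n) 1} {i : ℕ}
    (hv : h (m + i) v ≤ b - c / 2 ^ i) {k : ℕ} (hk : i ≤ k) :
    h (m + k) v ≤ b - c / 2 ^ k := by
  induction k, hk using Nat.le_induction with
  | base => exact hv
  | succ k hk ih =>
    have h2 : h (m + k) (reflect (u (m + k)) v) ≤ b := H.le_of_le hb k (sphereReflect _ v)
    rw [← add_assoc, H]
    have : c / 2 ^ (k + 1) = c / 2 ^ k / 2 := by rw [pow_succ]; field_simp
    rw [this]
    linarith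

/-- Points near `w` start with deficit `ε`. Any other point is reflected near `w` at some step of
the window and inherits half of the deficit remaining there. -/
theorem le_sub_window (H : IsReflectionAveraging u h) {m : ℕ} {b ε δ : ℝ}
    (hb : ∀ v : sphere (0 : E n) 1, h m v ≤ b) {w : sphere (0 : E n) 1}
    (hw : ∀ v : sphere (0 : E n) 1, dist v w < δ → h m v ≤ b - ε) {W : ℕ}
    (hW : ∀ v : sphere (0 : E n) 1, δ ≤ dist v w →
      ∃ j < W, dist (reflect (u (m + j)) v) w < δ) (v : sphere (0 : E n) 1) :
    h (m + W) v ≤ b - ε / 2 ^ W := by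
  have hnear : ∀ v : sphere (0 : E n) 1, dist v w < δ → ∀ k, h (m + k) v ≤ b - ε / 2 ^ k :=
    fun v hv k => H.le_sub_of_le_sub hb (i := 0) (by simpa using hw v hv) k.zero_le
  by_cases hv : dist v w < δ
  · exact hnear v hv W
  · obtain ⟨j, hj, hj'⟩ := hW v (not_lt.1 hv)
    refine H.le_sub_of_le_sub hb (i := j + 1) ?_ hj
    have h1 : h (m + j) (reflect (u (m + j)) v) ≤ b - ε / 2 ^ j :=
      hnear (sphereReflect _ v) hj' j
    have h2 := H.le_of_le hb j v
    rw [← add_assoc, H]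
    have : ε / 2 ^ (j + 1) = ε / 2 ^ j / 2 := by rw [pow_succ]; field_simp
    rw [this]
    linarith

theorem exists_oscillation_le {d : ℕ → sphere (0 : E n) 1} (hd : DenseRange d)
    (H : IsReflectionAveraging (rulerSeq d) h) {R : ℝ}
    (hR : ∀ m, ∀ v : sphere (0 : E n) 1, |h m v| ≤ R)
    (hlip : ∀ m, ∀ v w : sphere (0 : E n) 1, h m v - h m w ≤ R * dist v w)
    {ε : ℝ} (hε : 0 < ε) : ∃ m, ∀ v w : sphere (0 : E n) 1, h m v - h m w ≤ ε := by
  by_contra! hc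
  obtain ⟨v₀, -⟩ := hc 0
  have hR0 : 0 ≤ R := (abs_nonneg _).trans (hR 0 v₀)
  -- Makes `R * δ ≤ ε / 2`, so a deficit `ε` at `w` leaves `ε / 2` on the whole `δ`-ball; `R + 1`
  -- avoids division by zero.
  set δ := ε / (2 * (R + 1)) with hδ
  have hδ0 : 0 < δ := by positivity
  obtain ⟨W, hW⟩ := exists_window hd hδ0
  set c := ε / 2 / 2 ^ W with hcdef
  have hc0 : 0 < c := by positivity
  have key : ∀ j : ℕ, ∀ v : sphere (0 : E n) 1, h (j * W) v ≤ R - j * c := by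
    intro j
    induction j with
    | zero => intro v; simpa using (abs_le.1 (hR 0 v)).2
    | succ j ih =>
      obtain ⟨y, w, hyw⟩ := hc (j * W)
      have := H.le_sub_window ih (w := w) (ε := ε / 2) (δ := δ) (fun v hv => by
        have h1 := hlip (j * W) v w
        have h2 := ih y
        have h3 : R * dist v w ≤ ε / 2 := by
          calc R * dist v w ≤ (R + 1) * δ := by gcongr; linarith
            _ = ε / 2 := by rw [hδ]; field_simp
        linarith) (fun v hv => hW v w _ hv)
      intro v
      have h4 := this v
      rw [← hcdef] at h4
      rw [add_mul, one_mul]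
      push_cast
      linarith
  -- After this many windows the upper bound has dropped below `-R`.
  obtain ⟨j, hj⟩ := exists_nat_gt (2 * R / c)
  rw [div_lt_iff₀ hc0] at hj
  have h1 := key j v₀
  have h2 := (abs_le.1 (hR (j * W) v₀)).1
  linarith

/-- Upper bounds persist under averaging; applied to `h` and `-h`, this confines all later values to
the range reached at step `m`. -/
theorem exists_forall_abs_sub_le {d : ℕ → sphere (0 : E n) 1} (hd : DenseRange d)
    (H : IsReflectionAveraging (rulerSeq d) h) {R : ℝ}
    (hR : ∀ m, ∀ v : sphere (0 : E n) 1, |h m v| ≤ R)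
    (hlip : ∀ m, ∀ v w : sphere (0 : E n) 1, h m v - h m w ≤ R * dist v w)
    {ε : ℝ} (hε : 0 < ε) :
    ∃ m, ∀ k, ∀ v w : sphere (0 : E n) 1, |h (m + k) v - h m w| ≤ ε := by
  obtain ⟨m, hm⟩ := H.exists_oscillation_le hd hR hlip hε
  refine ⟨m, fun k v w => abs_le.2 ⟨?_, ?_⟩⟩
  · have := H.neg.le_of_le (m := m) (b := -h m w + ε) (fun v => by linarith [hm w v]) k v
    linarith
  · have := H.le_of_le (m := m) (b := h m w + ε) (fun v => by linarith [hm v w]) k v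
    linarith

theorem exists_uniform_limit {d : ℕ → sphere (0 : E n) 1} (hd : DenseRange d)
    (H : IsReflectionAveraging (rulerSeq d) h) {R : ℝ}
    (hR : ∀ m, ∀ v : sphere (0 : E n) 1, |h m v| ≤ R)
    (hlip : ∀ m, ∀ v w : sphere (0 : E n) 1, h m v - h m w ≤ R * dist v w) :
    ∃ r, ∀ ε > 0, ∀ᶠ m in atTop, ∀ v : sphere (0 : E n) 1, |h m v - r| ≤ ε := by
  let w := d 0
  have hcauchy : CauchySeq fun m => h m w := by
    rw [Metric.cauchySeq_iff']
    intro ε hε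
    obtain ⟨m, hm⟩ := H.exists_forall_abs_sub_le hd hR hlip (half_pos hε)
    refine ⟨m, fun k hk => ?_⟩
    obtain ⟨k, rfl⟩ := Nat.exists_eq_add_of_le hk
    exact (hm k w w).trans_lt (half_lt_self hε)
  obtain ⟨r, hr⟩ := cauchySeq_tendsto_of_complete hcauchy
  refine ⟨r, fun ε hε => ?_⟩
  obtain ⟨m, hm⟩ := H.exists_forall_abs_sub_le hd hR hlip (half_pos hε)
  have h1 : |r - h m w| ≤ ε / 2 := by
    refine le_of_tendsto (hr.sub_const (h m w)).abs ?_
    filter_upwards [eventually_ge_atTop m] with k hk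
    obtain ⟨k, rfl⟩ := Nat.exists_eq_add_of_le hk
    exact hm k w w
  filter_upwards [eventually_ge_atTop m] with k hk v
  obtain ⟨k, rfl⟩ := Nat.exists_eq_add_of_le hk
  have h2 := hm k v w
  rw [abs_le] at *
  constructor <;> linarith

end IsReflectionAveraging

/-! ### Existence of the symmetrization -/

/-- Let `p` be the point of `L` nearest to `x` and `v` the unit vector along `x - p`. Then `p`
maximizes the inner product with `v` on `L`, so `‖x - p‖ = ⟨x, v⟩ - supportFn L v ≤ r - (r - ε)`. -/
theorem exists_mem_norm_sub_le {L : Set (E n)} (hL : IsCompact L) (hconv : Convex ℝ L)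
    (hne : L.Nonempty) {r ε : ℝ} (hε : 0 ≤ ε)
    (h : ∀ v : sphere (0 : E n) 1, |supportFn L v - r| ≤ ε) {x : E n} (hx : ‖x‖ ≤ r) :
    ∃ p ∈ L, ‖p - x‖ ≤ ε := by
  obtain ⟨p, hp, hmin⟩ := exists_norm_eq_iInf_of_complete_convex hne hL.isComplete hconv x
  rw [norm_eq_iInf_iff_real_inner_le_zero hconv hp] at hmin
  refine ⟨p, hp, ?_⟩
  rw [norm_sub_rev]
  by_cases h0 : ‖x - p‖ = 0
  · rwa [h0]
  let v : sphere (0 : E n) 1 := ⟨‖x - p‖⁻¹ • (x - p), by simp [norm_smul, h0]⟩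
  obtain ⟨y, hy, hy'⟩ := exists_inner_eq_supportFn hL hne (v : E n)
  have hv1 : ‖(v : E n)‖ = 1 := by simp
  have h1 : inner ℝ (y - p) (v : E n) ≤ 0 := by
    change inner ℝ (y - p) (‖x - p‖⁻¹ • (x - p)) ≤ 0
    rw [inner_smul_right, real_inner_comm]
    exact mul_nonpos_of_nonneg_of_nonpos (by positivity) (hmin y hy)
  have h2 : inner ℝ (x - p) (v : E n) = ‖x - p‖ := by
    change inner ℝ (x - p) (‖x - p‖⁻¹ • (x - p)) = _
    rw [inner_smul_right, real_inner_self_eq_norm_sq]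
    field_simp
  have h3 := real_inner_le_norm x (v : E n)
  rw [hv1, mul_one] at h3
  rw [inner_sub_left] at h1 h2
  have h4 := (abs_le.1 (h v)).1
  linarith

theorem epiConverges_of_supportFn {L : ℕ → Set (E n)} (hL : ∀ m, IsCompact (L m))
    (hconv : ∀ m, Convex ℝ (L m)) (hne : ∀ m, (L m).Nonempty) {r : ℝ} (hr0 : 0 ≤ r)
    (h : ∀ ε > 0, ∀ᶠ m in atTop, ∀ v : sphere (0 : E n) 1, |supportFn (L m) v - r| ≤ ε) :
    EpiConverges (fun m => convexIndicator (L m)) (convexIndicator (closedBall 0 r)) := by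
  have hout : ∀ x : E n, x ∉ closedBall 0 r → ∀ xs : ℕ → E n, Tendsto xs atTop (𝓝 x) →
      ∀ᶠ m in atTop, convexIndicator (L m) (xs m) = ⊤ := by
    intro x hx xs hxs
    have hxr : r < ‖x‖ := by simpa using hx
    have hx0 : ‖x‖ ≠ 0 := (hr0.trans_lt hxr).ne'
    let v : sphere (0 : E n) 1 := ⟨‖x‖⁻¹ • x, by simp [norm_smul, hx0]⟩
    have h1 : Tendsto (fun m => inner ℝ (xs m) (v : E n)) atTop (𝓝 ‖x‖) := by
      have h2 := hxs.inner (tendsto_const_nhds (x := (v : E n))) (𝕜 := ℝ)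
      have h3 : inner ℝ x (v : E n) = ‖x‖ := by
        change inner ℝ x (‖x‖⁻¹ • x) = _
        rw [inner_smul_right, real_inner_self_eq_norm_sq]
        field_simp
      rwa [h3] at h2
    -- Both estimates meet at the midpoint of `r` and `‖x‖`: the support function is eventually at
    -- most this value, while the inner products exceed it.
    filter_upwards [h1.eventually_const_lt (show (r + ‖x‖) / 2 < ‖x‖ by linarith),
      h ((‖x‖ - r) / 2) (by linarith)] with m hm1 hm2
    refine convexIndicator_of_notMem fun hmem => ?_
    have h4 := inner_le_supportFn (hL m) hmem v
    have h5 := (abs_le.1 (hm2 v)).2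
    linarith
  intro x
  by_cases hx : x ∈ closedBall 0 r
  · rw [convexIndicator_of_mem hx]
    refine ⟨fun xs _ => le_liminf_of_le (by isBoundedDefault)
      (Eventually.of_forall fun m => convexIndicator_nonneg _ _), ?_⟩
    -- Points of `L m` nearest to `x` serve as the recovery sequence.
    choose p hp hmin using fun m =>
      (hL m).exists_isMinOn (hne m) (f := fun y => ‖y - x‖) (by fun_prop)
    refine ⟨p, ?_, ?_⟩
    · rw [tendsto_iff_norm_sub_tendsto_zero, Metric.tendsto_nhds]
      intro ε hε
      filter_upwards [h (ε / 2) (half_pos hε)] with m hm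
      obtain ⟨q, hq, hqx⟩ := exists_mem_norm_sub_le (hL m) (hconv m) (hne m) (half_pos hε).le hm
        (by simpa using hx)
      have h6 : ‖p m - x‖ ≤ ‖q - x‖ := hmin m hq
      rw [Real.dist_eq, sub_zero, abs_of_nonneg (norm_nonneg _)]
      linarith
    · simp only [convexIndicator_of_mem (hp _)]
      exact tendsto_const_nhds
  · rw [convexIndicator_of_notMem hx]
    refine ⟨fun xs hxs => ?_, fun _ => x, tendsto_const_nhds, ?_⟩
    · exact le_liminf_of_le (by isBoundedDefault)
        ((hout x hx xs hxs).mono fun m hm => hm.ge)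
    · exact tendsto_const_nhds.congr' ((hout x hx _ tendsto_const_nhds).mono fun m hm => hm.symm)

/-- Used to see that the limiting radius is nonnegative, by passing to the limit in opposite
directions. -/
theorem supportFn_add_neg_nonneg {L : Set (E n)} (hL : IsCompact L) (hne : L.Nonempty) (v : E n) :
    0 ≤ supportFn L v + supportFn L (-v) := by
  obtain ⟨x, hx⟩ := hne
  have h1 := inner_le_supportFn hL hx v
  have h2 := inner_le_supportFn hL hx (-v)
  rw [inner_neg_right] at h2
  linarith

theorem exists_epiConverges_setSymIter [NeZero n] {K : Set (E n)} (hK : IsCompact K)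
    (hconv : Convex ℝ K) (hne : K.Nonempty) :
    ∃ (u : ℕ → sphere (0 : E n) 1) (r : ℝ), 0 ≤ r ∧ meanWidthBall K = closedBall 0 r ∧
      EpiConverges (fun m => convexIndicator (setSymIter u K m))
        (convexIndicator (closedBall 0 r)) := by
  have : Nonempty (sphere (0 : E n) 1) := (NormedSpace.sphere_nonempty.2 zero_le_one).to_subtype
  have hd := TopologicalSpace.denseRange_denseSeq (sphere (0 : E n) 1)
  set d := TopologicalSpace.denseSeq (sphere (0 : E n) 1)
  have hc := isCompact_setSymIter (rulerSeq d) hK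
  have hn := nonempty_setSymIter (rulerSeq d) hne
  obtain ⟨R, hR⟩ := hK.isBounded.subset_closedBall 0
  have hball := setSymIter_subset_closedBall (rulerSeq d) hR
  have H : IsReflectionAveraging (rulerSeq d) fun m => supportFn (setSymIter (rulerSeq d) K m) :=
    fun m v => supportFn_setSym _ (hc m) (hn m) v
  obtain ⟨r, hr⟩ := H.exists_uniform_limit hd (R := R)
    (fun m v => by simpa using abs_supportFn_le (hc m) (hn m) (hball m) (v : E n))
    (fun m v w => by
      have := supportFn_sub_le (hc m) (hn m) (hball m) (v : E n) w
      rwa [← dist_eq_norm] at this)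
  have hlim : ∀ v : sphere (0 : E n) 1,
      Tendsto (fun m => supportFn (setSymIter (rulerSeq d) K m) v) atTop (𝓝 r) := by
    intro v
    rw [Metric.tendsto_nhds]
    intro ε hε
    filter_upwards [hr (ε / 2) (half_pos hε)] with m hm
    exact (hm v).trans_lt (half_lt_self hε)
  have hr0 : 0 ≤ r := by
    have h1 := (hlim (d 0)).add (hlim (-d 0))
    have h2 : 0 ≤ r + r := ge_of_tendsto h1 (Eventually.of_forall fun m =>
      supportFn_add_neg_nonneg (hc m) (hn m) (d 0 : E n))
    linarith
  exact ⟨rulerSeq d, r, hr0, meanWidthBall_eq_closedBall hr0 (meanWidth_eq_of_tendsto hc hn hball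
    (meanWidth_setSymIter (rulerSeq d) hK hne) hlim), epiConverges_of_supportFn hc
    (convex_setSymIter (rulerSeq d) hconv) hn hr0 hr⟩

theorem isConvC_convexIndicator {C : Set (E n)} (hC : IsCompact C) (hconv : Convex ℝ C)
    (hne : C.Nonempty) : IsConvC (convexIndicator C) where
  convex := by
    simp only [convexIndicator_le_coe_iff]
    rintro ⟨x, s⟩ ⟨hx, hs⟩ ⟨y, t⟩ ⟨hy, ht⟩ a b ha hb hab
    exact ⟨hconv hx hy ha hb hab, add_nonneg (mul_nonneg ha hs) (mul_nonneg hb ht)⟩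
  coercive := by
    have : ∀ᶠ x in Bornology.cobounded (E n), convexIndicator C x = ⊤ := by
      have h : Cᶜ ∈ Bornology.cobounded (E n) := Bornology.isBounded_def.1 hC.isBounded
      filter_upwards [h] with x hx using convexIndicator_of_notMem hx
    exact tendsto_const_nhds.congr' (this.mono fun x hx => hx.symm)
  dom_nonempty := by
    obtain ⟨x, hx⟩ := hne
    exact ⟨x, by simp [convexIndicator_of_mem hx]⟩
  ne_bot x := (EReal.bot_lt_zero.trans_le (convexIndicator_nonneg C x)).ne'
  lsc := by
    intro x y hy
    by_cases hx : x ∈ C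
    · rw [convexIndicator_of_mem hx] at hy
      exact Eventually.of_forall fun z => hy.trans_le (convexIndicator_nonneg C z)
    · filter_upwards [hC.isClosed.isOpen_compl.mem_nhds hx] with z hz
      rwa [convexIndicator_of_notMem hz, ← convexIndicator_of_notMem hx]

theorem isEpiSymmetrization_convexIndicator_iff [NeZero n] {K : Set (E n)} (hK : IsCompact K)
    (hconv : Convex ℝ K) (hne : K.Nonempty) (φ : E n → EReal) :
    IsEpiSymmetrization (convexIndicator K) φ ↔ φ = convexIndicator (meanWidthBall K) := by
  refine ⟨fun h => h.eq_convexIndicator_meanWidthBall hK hne, ?_⟩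
  rintro rfl
  obtain ⟨u, r, hr, hball, hepi⟩ := exists_epiConverges_setSymIter hK hconv hne
  rw [hball]
  refine ⟨isConvC_convexIndicator (isCompact_closedBall 0 r) (convex_closedBall 0 r)
    ⟨0, by simpa⟩, fun θ x => by simp [convexIndicator], u, id, strictMono_id, ?_⟩
  simpa only [minkSymIter_convexIndicator, id] using hepi

/-! ### Hypo-symmetrization -/

/-- Since `1 ^ α = 1` and `log 1 = 0`, the value on `K` is `0` for every `α`; off `K` it is `⊤` by
the convention in `base`. -/
theorem base_charFn (α : ℝ) (K : Set (E n)) : base α (charFn K) = convexIndicator K := by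
  funext x
  by_cases hx : x ∈ K
  · simp [base, charFn, convexIndicator, hx]
  · simp [base, charFn, convexIndicator, hx]

theorem ofBase_convexIndicator (α : ℝ) (C : Set (E n)) :
    ofBase α (convexIndicator C) = charFn C := by
  funext x
  by_cases hx : x ∈ C
  · simp [ofBase, charFn, convexIndicator, hx]
  · simp [ofBase, charFn, convexIndicator, hx]

end HypoSym

end

/-- For a convex body `K`, the ball indicator `I_{K_w^*}^∞` is the epi-limit of a full sequence of
successive Minkowski symmetrizations of `I_K^∞`; it is the one and only epi-symmetrization of
`I_K^∞`; and `1_{K_w^*}` is the one and only hypo-symmetrization of `1_K`, for every `α`. -/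
theorem lemma6p5 (n : ℕ) (hn : 1 ≤ n) (K : Set (HypoSym.E n)) (hK : HypoSym.IsConvexBody K) :
    (∃ u : ℕ → Metric.sphere (0 : HypoSym.E n) 1,
      HypoSym.EpiConverges (HypoSym.minkSymIter u (HypoSym.convexIndicator K))
        (HypoSym.convexIndicator (HypoSym.meanWidthBall K))) ∧
    (∀ φ : HypoSym.E n → EReal,
      HypoSym.IsEpiSymmetrization (HypoSym.convexIndicator K) φ ↔
        φ = HypoSym.convexIndicator (HypoSym.meanWidthBall K)) ∧
    (∀ (α : ℝ) (g : HypoSym.E n → ℝ),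
      HypoSym.IsHypoSymmetrization α (HypoSym.charFn K) g ↔
        g = HypoSym.charFn (HypoSym.meanWidthBall K)) := by
  have : NeZero n := ⟨by omega⟩
  have hne : K.Nonempty := hK.interior_nonempty.mono interior_subset
  have hiff := HypoSym.isEpiSymmetrization_convexIndicator_iff hK.compact hK.convex hne
  refine ⟨?_, hiff, fun α g => ?_⟩
  · obtain ⟨u, r, -, hball, hepi⟩ :=
      HypoSym.exists_epiConverges_setSymIter hK.compact hK.convex hne
    refine ⟨u, ?_⟩
    rw [hball]
    simpa only [← HypoSym.minkSymIter_convexIndicator] using hepi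
  · simp only [HypoSym.IsHypoSymmetrization, HypoSym.base_charFn, hiff, exists_eq_left,
      HypoSym.ofBase_convexIndicator]
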